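/- Let $\mathcal H$ be a separable infinite-dimensional complex Hilbert space and let $p,q\in\mathcal B(\mathcal H)$ be (orthogonal) projections. Write $p^\perp=1-p$, let $p\wedge q$ denote the orthogonal projection onto $p\mathcal H\cap q\mathcal H$, and let $\|x\|_{ess}$ denote the norm of the image of $x\in\mathcal B(\mathcal H)$ in the quotient of $\mathcal B(\mathcal H)$ by the ideal of compact operators. The pair $(p,q)$ is called a Fredholm pair if the operator $q|_{p\mathcal H}\in\mathcal B(p\mathcal H,q\mathcal H)$ is Fredholm; in that case $[p:q]:=\operatorname{ind}(q|_{p\mathcal H})=\dim\ker(q|_{p\mathcal H})-\dim\operatorname{coker}(q|_{p\mathcal H})$. Then $(p,q)$ is a Fredholm pair if and only if $\|p-q\|_{ess}<1$. In that case the projections $p\wedge q^\perp$ and $p^\perp\wedge q$ are finite (that is, they have finite rank; equivalently, finite trace), and $$[p:q]=\operatorname{tr}(p\wedge q^\perp)-\operatorname{tr}(p^\perp\wedge q).$$ -/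

import Mathlib

open scoped ENNReal InnerProductSpace

/-- The essential norm `‖x‖_ess` of `x ∈ B(H)`: the norm of the image of `x` in the quotient
of `B(H)` by the compact operators (the Calkin algebra). -/
noncomputable def essNorm {H : Type*} [NormedAddCommGroup H] [InnerProductSpace ℂ H]
    (x : H →L[ℂ] H) : ℝ :=
  ‖(Submodule.Quotient.mk x : (H →L[ℂ] H) ⧸ compactOperator (RingHom.id ℂ) H H)‖

/-- The index `dim ker T - dim coker T` of a Fredholm operator (meaningful for Fredholm `T`
only, when both dimensions are finite). -/
noncomputable def fredholmIndex {E F : Type*} [NormedAddCommGroup E] [NormedSpace ℂ E]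
    [NormedAddCommGroup F] [NormedSpace ℂ F] (T : E →L[ℂ] F) : ℤ :=
  (Module.finrank ℂ T.ker : ℤ) - (Module.finrank ℂ (F ⧸ T.range) : ℤ)

/-- The operator `q|_{pH}`, as an element of `B(pH, qH)`. -/
noncomputable def restrictPair {H : Type*} [NormedAddCommGroup H] [InnerProductSpace ℂ H]
    (p q : H →L[ℂ] H) : p.range →L[ℂ] q.range :=
  (q ∘L p.range.subtypeL).codRestrict q.range (fun x => ⟨(x : H), rfl⟩)

/-- `(p, q)` is a Fredholm pair: `q|_{pH} ∈ B(pH, qH)` is a Fredholm operator. -/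
def IsFredholmPair {H : Type*} [NormedAddCommGroup H] [InnerProductSpace ℂ H]
    (p q : H →L[ℂ] H) : Prop :=
  (restrictPair p q).IsFredholm

/-- The index `[p : q]` of a Fredholm pair of projections. -/
noncomputable def pairIndex {H : Type*} [NormedAddCommGroup H] [InnerProductSpace ℂ H]
    (p q : H →L[ℂ] H) : ℤ :=
  fredholmIndex (restrictPair p q)

/-- The meet `p ∧ q` of two projections: the orthogonal projection onto `pH ∩ qH`. (This
intersection is closed when `p` and `q` are projections, see `range_projInf`; the closure is
there to make the definition total.) -/
noncomputable def projInf {H : Type*} [NormedAddCommGroup H] [InnerProductSpace ℂ H]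
    [CompleteSpace H] (p q : H →L[ℂ] H) : H →L[ℂ] H :=
  (p.range ⊓ q.range).topologicalClosure.starProjection

theorem range_projInf {H : Type*} [NormedAddCommGroup H] [InnerProductSpace ℂ H]
    [CompleteSpace H] {p q : H →L[ℂ] H} (hp : IsStarProjection p) (hq : IsStarProjection q) :
    (projInf p q).range = p.range ⊓ q.range := by
  have h : IsClosed ((p.range ⊓ q.range : Submodule ℂ H) : Set H) := by
    rw [Submodule.coe_inf]
    exact (ContinuousLinearMap.IsIdempotentElem.isClosed_range hp.isIdempotentElem).inter
      (ContinuousLinearMap.IsIdempotentElem.isClosed_range hq.isIdempotentElem)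
  rw [projInf, Submodule.range_starProjection]
  exact IsClosed.submodule_topologicalClosure_eq h

/-- A projection of `B(H)` is finite if its range is finite dimensional. -/
def IsFiniteProj {H : Type*} [NormedAddCommGroup H] [InnerProductSpace ℂ H]
    (p : H →L[ℂ] H) : Prop :=
  FiniteDimensional ℂ p.range

/-- The trace `∑ᵢ ⟨x eᵢ, eᵢ⟩ ∈ [0, ∞]` of a positive operator, computed in the Hilbert basis `e`. -/
noncomputable def traceIn {H : Type*} [NormedAddCommGroup H] [InnerProductSpace ℂ H]
    {ι : Type*} (e : HilbertBasis ι ℂ H) (x : H →L[ℂ] H) : ℝ≥0∞ :=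
  ∑' i, ENNReal.ofReal (RCLike.re ⟪x (e i), e i⟫_ℂ)

/-- The trace of a positive operator, with values in `[0, ∞]`. It is computed in some Hilbert
basis, and does not depend on the choice, see `opTrace_eq_traceIn`. -/
noncomputable def opTrace {H : Type*} [NormedAddCommGroup H] [InnerProductSpace ℂ H]
    [CompleteSpace H] (x : H →L[ℂ] H) : ℝ≥0∞ :=
  traceIn (exists_hilbertBasis ℂ H).choose_spec.choose x

theorem tsum_ofReal_norm_inner_sq {H : Type*} [NormedAddCommGroup H]
    [InnerProductSpace ℂ H] {ι : Type*} (e : HilbertBasis ι ℂ H) (v : H) :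
    ∑' i, ENNReal.ofReal (‖⟪e i, v⟫_ℂ‖ ^ 2) = ENNReal.ofReal (‖v‖ ^ 2) := by
  have h2 : HasSum (fun i => ‖⟪e i, v⟫_ℂ‖ ^ 2) (‖v‖ ^ 2) := by
    have h3 := Complex.hasSum_re (e.hasSum_inner_mul_inner v v)
    have h4 : (⟪v, v⟫_ℂ).re = ‖v‖ ^ 2 := by
      rw [inner_self_eq_norm_sq_to_K]; norm_cast
    rw [h4] at h3
    convert h3 using 2 with i
    rw [← inner_conj_symm v (e i), RCLike.conj_mul]
    norm_cast
  rw [← ENNReal.ofReal_tsum_of_nonneg (fun i => by positivity) h2.summable, h2.tsum_eq]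

theorem traceIn_eq_traceIn {H : Type*} [NormedAddCommGroup H] [InnerProductSpace ℂ H]
    [CompleteSpace H] {x : H →L[ℂ] H} (hx : 0 ≤ x) {ι κ : Type*} (e : HilbertBasis ι ℂ H)
    (f : HilbertBasis κ ℂ H) : traceIn e x = traceIn f x := by
  obtain ⟨s, hs, rfl⟩ : ∃ s : H →L[ℂ] H, IsSelfAdjoint s ∧ s * s = x :=
    ⟨CFC.sqrt x, (CFC.sqrt_nonneg x).isSelfAdjoint, CFC.sqrt_mul_sqrt_self x hx⟩
  have hsym : ∀ u v : H, ⟪s u, v⟫_ℂ = ⟪u, s v⟫_ℂ := hs.isSymmetric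
  have key : ∀ v : H, RCLike.re ⟪(s * s) v, v⟫_ℂ = ‖s v‖ ^ 2 := by
    intro v
    change RCLike.re ⟪s (s v), v⟫_ℂ = ‖s v‖ ^ 2
    rw [hsym, inner_self_eq_norm_sq]
  simp only [traceIn, key]
  calc ∑' i, ENNReal.ofReal (‖s (e i)‖ ^ 2)
      = ∑' i, ∑' k, ENNReal.ofReal (‖⟪f k, s (e i)⟫_ℂ‖ ^ 2) :=
        tsum_congr fun i => (tsum_ofReal_norm_inner_sq f _).symm
    _ = ∑' k, ∑' i, ENNReal.ofReal (‖⟪f k, s (e i)⟫_ℂ‖ ^ 2) := ENNReal.tsum_comm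
    _ = ∑' k, ENNReal.ofReal (‖s (f k)‖ ^ 2) := by
        refine tsum_congr fun k => ?_
        rw [← tsum_ofReal_norm_inner_sq e]
        refine tsum_congr fun i => ?_
        rw [← hsym, norm_inner_symm]

theorem opTrace_eq_traceIn {H : Type*} [NormedAddCommGroup H] [InnerProductSpace ℂ H]
    [CompleteSpace H] {x : H →L[ℂ] H} (hx : 0 ≤ x) {ι : Type*} (e : HilbertBasis ι ℂ H) :
    opTrace x = traceIn e x :=
  traceIn_eq_traceIn hx _ e

/-! Suppose `‖p - q‖_ess < 1`. Compact operators are norm limits of finite rank ones, so `p - q` is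
a finite rank perturbation of some `b` with `‖b‖ < 1`. The identity `p (p - q)² p = p - pqp` gives
`pqp = (1 - p b² p) p` modulo finite rank, and the first factor is a unit (`exists_isUnit_mul_eq`).
This yields a left inverse of `q|_{pH}` modulo finite rank; exchanging `p` and `q` yields a right
one.

Conversely, the kernel of `q|_{pH}` is `pH ∩ (1-q)H`, and the orthogonal complement of its range in
`qH` is `(1-p)H ∩ qH`. Both are finite dimensional for a Fredholm pair, and counting dimensions
gives the index formula. Closed range bounds `q` below on `pH` and `p` below on `qH` off these
spaces (`IsFredholmPair.exists_norm_le`). Then `‖(p-q)x‖² = ‖p(1-q)x‖² + ‖(1-p)qx‖²` makes `p - q` a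
strict contraction orthogonally to both spaces, that is, up to finite rank. -/

/-! ### Finite rank operators and approximation of compact operators. -/

section FiniteRange

theorem LinearMap.hasFiniteRange_of_forall_mem {K V W X : Type*} [Field K] [AddCommGroup V]
    [Module K V] [AddCommGroup W] [Module K W] [AddCommGroup X] [Module K X]
    (g : V →ₗ[K] W) (i : W →ₗ[K] X) (hi : Function.Injective i) {S : Submodule K X} (hS : S.FG)
    (h : ∀ x, i (g x) ∈ S) : g.HasFiniteRange := by
  have : FiniteDimensional K S := Module.Finite.of_fg hS
  have h1 : (g.range.map i) ≤ S := by
    rintro _ ⟨_, ⟨x, rfl⟩, rfl⟩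
    exact h x
  have : FiniteDimensional K (g.range.map i) := Submodule.finiteDimensional_of_le h1
  have : FiniteDimensional K g.range :=
    Module.Finite.equiv (Submodule.equivMapOfInjective i hi g.range).symm
  exact Module.Finite.iff_fg.mp this

open LinearMap.FiniteRangeSetoid in
-- As for inverses in a monoid: `l ≈ l u r ≈ r` modulo finite rank.
theorem LinearMap.IsLeftQuasiInverse.isQuasiInverse_of_isRightQuasiInverse {K V W : Type*} [Field K]
    [AddCommGroup V] [Module K V] [AddCommGroup W] [Module K W] {u : V →ₗ[K] W} {l r : W →ₗ[K] V}
    (hl : l.IsLeftQuasiInverse u) (hr : r.IsRightQuasiInverse u) : l.IsQuasiInverse u := by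
  refine ⟨hl, ?_⟩
  have h1 : l ∘ₗ (u ∘ₗ r) ≈ l ∘ₗ LinearMap.id := equiv_comp_left hr
  have h2 : (l ∘ₗ u) ∘ₗ r ≈ LinearMap.id ∘ₗ r := equiv_comp_right hl
  have h3 : l ≈ r := Setoid.trans (Setoid.symm h1) h2
  exact Setoid.trans (equiv_comp_left h3) hr

/-- Cover the image of the unit ball by finitely many small balls and project orthogonally onto the
span of their centres; the projection is at least as close as any centre. -/
theorem IsCompactOperator.exists_hasFiniteRange_norm_sub_lt {𝕜 E F : Type*} [RCLike 𝕜]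
    [NormedAddCommGroup E] [NormedSpace 𝕜 E] [NormedAddCommGroup F] [InnerProductSpace 𝕜 F]
    {T : E →L[𝕜] F} (hT : IsCompactOperator T) {ε : ℝ} (hε : 0 < ε) :
    ∃ R : E →L[𝕜] F, R.toLinearMap.HasFiniteRange ∧ ‖T - R‖ < ε := by
  obtain ⟨K, hK, hTK⟩ := IsCompactOperator.image_closedBall_subset_compact (𝕜₁ := 𝕜)
    (f := T.toLinearMap) hT 1
  obtain ⟨t, -, ht, hKt⟩ := hK.finite_cover_balls (half_pos hε)
  have : FiniteDimensional 𝕜 (Submodule.span 𝕜 t) := FiniteDimensional.span_of_finite 𝕜 ht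
  refine ⟨(Submodule.span 𝕜 t).starProjection ∘L T, ?_, ?_⟩
  · refine LinearMap.hasFiniteRange_of_forall_mem _ LinearMap.id Function.injective_id
      (Module.Finite.iff_fg.mp this) fun x => ?_
    exact Submodule.starProjection_apply_mem _ _
  · refine lt_of_le_of_lt (ContinuousLinearMap.opNorm_le_of_unit_norm (C := ε / 2) (by positivity)
      fun x hx => ?_) (half_lt_self hε)
    have hx' : T x ∈ ⋃ y ∈ t, Metric.ball y (ε / 2) :=
      hKt (hTK ⟨x, mem_closedBall_zero_iff.mpr hx.le, rfl⟩)
    obtain ⟨y, hy, hxy⟩ := Set.mem_iUnion₂.mp hx'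
    change ‖T x - (Submodule.span 𝕜 t).starProjection (T x)‖ ≤ _
    rw [Submodule.starProjection_minimal]
    refine (ciInf_le ⟨0, ?_⟩ (⟨y, Submodule.subset_span hy⟩ : Submodule.span 𝕜 t)).trans ?_
    · rintro _ ⟨z, rfl⟩
      exact norm_nonneg _
    · rw [← dist_eq_norm]
      exact (Metric.mem_ball.mp hxy).le

end FiniteRange

/-! ### The essential norm through finite rank perturbations. -/

section EssNorm

variable {H : Type*} [NormedAddCommGroup H] [InnerProductSpace ℂ H]

theorem essNorm_lt_of_hasFiniteRange_sub {x y : H →L[ℂ] H} {r : ℝ}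
    (h : (x - y).toLinearMap.HasFiniteRange) (hy : ‖y‖ < r) : essNorm x < r := by
  have : x - y ∈ compactOperator (RingHom.id ℂ) H H := by
    have : FiniteDimensional ℂ (x - y).range := Module.Finite.of_fg h
    have : ProperSpace (x - y).range := FiniteDimensional.proper ℂ _
    exact (isCompactOperator_of_locallyCompactSpace_dom (x - y).rangeRestrict).clm_comp
      (x - y).range.subtypeL
  have h1 : (Submodule.Quotient.mk x : (H →L[ℂ] H) ⧸ compactOperator (RingHom.id ℂ) H H)
      = Submodule.Quotient.mk y := (Submodule.Quotient.eq _).mpr this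
  rw [essNorm, h1]
  exact (Submodule.Quotient.norm_mk_le _ _).trans_lt hy

theorem exists_hasFiniteRange_sub_of_essNorm_lt {x : H →L[ℂ] H} {r : ℝ} (h : essNorm x < r) :
    ∃ y : H →L[ℂ] H, (x - y).toLinearMap.HasFiniteRange ∧ ‖y‖ < r := by
  obtain ⟨z, hz, hzr⟩ := Submodule.Quotient.norm_mk_lt
    (Submodule.Quotient.mk x : (H →L[ℂ] H) ⧸ compactOperator (RingHom.id ℂ) H H)
    (half_pos (sub_pos.mpr h))
  change _ < essNorm x + _ at hzr
  have hc : IsCompactOperator (x - z) := (Submodule.Quotient.eq _).mp hz.symm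
  obtain ⟨R, hR, hRn⟩ := IsCompactOperator.exists_hasFiniteRange_norm_sub_lt
    (T := x - z) hc (half_pos (sub_pos.mpr h))
  -- `x - R` is the near-optimal lift `z` plus the error `x - z - R`; each uses up half of the gap
  -- `r - essNorm x`.
  refine ⟨x - R, by simpa using hR, ?_⟩
  have : x - R = z + (x - z - R) := by abel
  rw [this]
  refine (norm_add_le _ _).trans_lt ?_
  linarith

end EssNorm

/-! ### The trace of a finite rank projection. -/

section Trace

variable {H : Type*} [NormedAddCommGroup H] [InnerProductSpace ℂ H]

theorem traceIn_starProjection {ι : Type*} (e : HilbertBasis ι ℂ H) (V : Submodule ℂ H)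
    [FiniteDimensional ℂ V] : traceIn e V.starProjection = Module.finrank ℂ V := by
  let f := stdOrthonormalBasis ℂ V
  have key (v : H) : RCLike.re ⟪V.starProjection v, v⟫_ℂ = ∑ k, ‖⟪v, (f k : H)⟫_ℂ‖ ^ 2 := by
    rw [V.re_inner_starProjection_eq_normSq, ← f.sum_sq_norm_inner_left]
    refine Finset.sum_congr rfl fun k _ => ?_
    rw [← V.starProjection_eq_self_iff.mpr (f k).2, ← V.inner_starProjection_left_eq_right]
    rfl
  simp only [traceIn, key]
  calc ∑' i, ENNReal.ofReal (∑ k, ‖⟪e i, (f k : H)⟫_ℂ‖ ^ 2)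
      = ∑' i, ∑ k, ENNReal.ofReal (‖⟪e i, (f k : H)⟫_ℂ‖ ^ 2) :=
        tsum_congr fun i => ENNReal.ofReal_sum_of_nonneg fun k _ => by positivity
    _ = ∑ k, ∑' i, ENNReal.ofReal (‖⟪e i, (f k : H)⟫_ℂ‖ ^ 2) :=
        Summable.tsum_finsetSum fun k _ => ENNReal.summable
    _ = ∑ k, 1 := by
        refine Finset.sum_congr rfl fun k _ => ?_
        rw [tsum_ofReal_norm_inner_sq, ← Submodule.coe_norm, f.norm_eq_one]
        simp
    _ = Module.finrank ℂ V := by simp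

theorem opTrace_starProjection [CompleteSpace H] (V : Submodule ℂ H)
    [FiniteDimensional ℂ V] : opTrace V.starProjection = Module.finrank ℂ V :=
  traceIn_starProjection _ V

end Trace

/-! ### Essential norm below one implies Fredholm. -/

section FredholmOfEssNorm

variable {H : Type*} [NormedAddCommGroup H] [InnerProductSpace ℂ H]

theorem IsIdempotentElem.apply_of_mem_range {p : H →L[ℂ] H} (hp : IsIdempotentElem p) {x : H}
    (hx : x ∈ p.range) : p x = x := by
  obtain ⟨y, rfl⟩ := hx
  exact DFunLike.congr_fun hp.eq y

@[simp]
theorem coe_restrictPair_apply (p q : H →L[ℂ] H) (x : p.range) :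
    (restrictPair p q x : H) = q x := rfl

theorem IsStarProjection.norm_apply_le [CompleteSpace H] {p : H →L[ℂ] H}
    (hp : IsStarProjection p) (x : H) : ‖p x‖ ≤ ‖x‖ := by
  obtain ⟨_, h⟩ := isStarProjection_iff_eq_starProjection_range.mp hp
  rw [h]
  exact Submodule.norm_starProjection_apply_le _ _

theorem IsStarProjection.opNorm_le_one [CompleteSpace H] {p : H →L[ℂ] H}
    (hp : IsStarProjection p) : ‖p‖ ≤ 1 :=
  ContinuousLinearMap.opNorm_le_bound _ zero_le_one fun x => by
    simpa using hp.norm_apply_le x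

theorem isUnit_one_sub_conj_mul_self [CompleteSpace H] {p b : H →L[ℂ] H}
    (hp : IsStarProjection p) (hb : ‖b‖ < 1) : IsUnit (1 - p * (b * b) * p) := by
  refine isUnit_one_sub_of_norm_lt_one ?_
  have hp1 := hp.opNorm_le_one
  calc ‖p * (b * b) * p‖ ≤ ‖p‖ * (‖b‖ * ‖b‖) * ‖p‖ := by
        refine (norm_mul_le _ _).trans ?_
        gcongr
        refine (norm_mul_le _ _).trans ?_
        gcongr
        exact norm_mul_le _ _
    _ ≤ 1 * (‖b‖ * ‖b‖) * 1 := by gcongr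
    _ < 1 := by nlinarith [norm_nonneg b]

theorem hasFiniteRange_mul_self_sub {a b : H →L[ℂ] H}
    (h : (a - b).toLinearMap.HasFiniteRange) :
    (a * a - b * b).toLinearMap.HasFiniteRange := by
  have h1 : (a * a - b * b).toLinearMap = a.toLinearMap ∘ₗ (a - b).toLinearMap
      + (a - b).toLinearMap ∘ₗ b.toLinearMap := by
    ext x
    simp
  rw [h1]
  exact (h.comp_left _).add (h.comp_right _)

theorem IsIdempotentElem.mul_sub_mul_self_mul {R : Type*} [Ring R] {p q : R}
    (hp : IsIdempotentElem p) (hq : IsIdempotentElem q) :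
    p * ((p - q) * (p - q)) * p = p - p * q * p := by
  have hp' := hp.eq
  have hq' := hq.eq
  have h : (p - q) * (p - q) = p - p * q - q * p + q := by
    rw [sub_mul, mul_sub, mul_sub, hp', hq']; abel
  rw [h]
  simp only [mul_add, mul_sub, add_mul, sub_mul, hp', mul_assoc]
  simp only [← mul_assoc, hp']
  abel

/-- The unit `1 - p b² p` commutes with `p`, so it can stand on either side: the left form serves
the left quasi-inverse, the right form the right one. -/
theorem exists_isUnit_mul_eq [CompleteSpace H] {p q : H →L[ℂ] H} (hp : IsStarProjection p)
    (hq : IsStarProjection q) (h : essNorm (p - q) < 1) :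
    ∃ u f : H →L[ℂ] H, IsUnit u ∧ f.toLinearMap.HasFiniteRange ∧ p * q * p = u * p + f ∧
      p * q * p = p * u + f := by
  obtain ⟨b, hf, hb⟩ := exists_hasFiniteRange_sub_of_essNorm_lt h
  have hpp := hp.isIdempotentElem.eq
  have key : p * ((p - q) * (p - q) - b * b) * p = p - p * q * p - p * (b * b) * p := by
    rw [mul_sub p (_ * _) (b * b), sub_mul _ _ p,
      hp.isIdempotentElem.mul_sub_mul_self_mul hq.isIdempotentElem]
  refine ⟨1 - p * (b * b) * p, -(p * ((p - q) * (p - q) - b * b) * p),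
    isUnit_one_sub_conj_mul_self hp hb, ?_, ?_, ?_⟩
  · exact (((hasFiniteRange_mul_self_sub hf).comp_left p.toLinearMap).comp_right
      p.toLinearMap).neg
  · rw [key, sub_mul, mul_assoc _ p p, hpp, one_mul]
    abel
  · rw [key, mul_sub p 1, mul_assoc p (b * b) p, ← mul_assoc p p, hpp, mul_one]
    abel

open LinearMap.FiniteRangeSetoid in
theorem isFredholmPair_of_essNorm_lt_one [CompleteSpace H] {p q : H →L[ℂ] H}
    (hp : IsStarProjection p) (hq : IsStarProjection q) (h : essNorm (p - q) < 1) :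
    IsFredholmPair p q := by
  have h' : essNorm (q - p) < 1 := by
    have : essNorm (q - p) = essNorm (p - q) := by
      rw [← neg_sub p q, essNorm, Submodule.Quotient.mk_neg, norm_neg, essNorm]
    rwa [this]
  obtain ⟨u, f, hu, hf, hpu, -⟩ := exists_isUnit_mul_eq hp hq h
  obtain ⟨w, g, hw, hg, -, hqw⟩ := exists_isUnit_mul_eq hq hp h'
  obtain ⟨s, hs⟩ := hu.exists_left_inv
  obtain ⟨t, ht⟩ := hw.exists_right_inv
  -- From `pqp = up + f` and `su = 1`: on `pH`, `psp ∘ q = 1 + psf`.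
  let l : q.range →L[ℂ] p.range :=
    (p ∘L s ∘L p ∘L q.range.subtypeL).codRestrict p.range fun x => ⟨_, rfl⟩
  -- From `qpq = qw + g` and `wt = 1`: on `qH`, `q ∘ pqt = 1 + gt`.
  let r : q.range →L[ℂ] p.range :=
    (p ∘L q ∘L t ∘L q.range.subtypeL).codRestrict p.range fun x => ⟨_, rfl⟩
  have hl : l.toLinearMap.IsLeftQuasiInverse (restrictPair p q).toLinearMap := by
    refine equiv_iff_hasFiniteRange.mpr ?_
    refine LinearMap.hasFiniteRange_of_forall_mem _ p.range.subtype Subtype.val_injective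
      (hf.comp_left (p ∘L s).toLinearMap) fun x => ?_
    have hx := hp.isIdempotentElem.apply_of_mem_range x.2
    refine ⟨x, ?_⟩
    have h1 : p (q (p x)) = u (p x) + f x := DFunLike.congr_fun hpu (x : H)
    have h2 : s (u x) = x := DFunLike.congr_fun hs (x : H)
    change p (s (f x)) = p (s (p (q x))) - x
    rw [hx] at h1
    rw [h1, map_add, map_add, h2, hx]
    abel
  have hr : r.toLinearMap.IsRightQuasiInverse (restrictPair p q).toLinearMap := by
    refine equiv_iff_hasFiniteRange.mpr ?_
    refine LinearMap.hasFiniteRange_of_forall_mem _ q.range.subtype Subtype.val_injective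
      (hg.comp_right t.toLinearMap) fun x => ?_
    have hx := hq.isIdempotentElem.apply_of_mem_range x.2
    refine ⟨x, ?_⟩
    have h1 : q (p (q (t x))) = q (w (t x)) + g (t x) := DFunLike.congr_fun hqw (t x)
    have h2 : w (t x) = x := DFunLike.congr_fun ht (x : H)
    change g (t x) = q (p (q (t x))) - x
    rw [h1, h2, hx]
    abel
  exact ContinuousLinearMap.IsFredholm.of_isQuasiInverse
    (hl.isQuasiInverse_of_isRightQuasiInverse hr)

end FredholmOfEssNorm

/-! ### Kernel and cokernel of a Fredholm pair; Fredholm implies essential norm below one. -/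

section EssNormOfFredholm

variable {H : Type*} [NormedAddCommGroup H] [InnerProductSpace ℂ H]

theorem IsIdempotentElem.mem_range_iff {p : H →L[ℂ] H} (hp : IsIdempotentElem p) {x : H} :
    x ∈ p.range ↔ p x = x :=
  ⟨fun h => hp.apply_of_mem_range h, fun h => ⟨x, h⟩⟩

theorem IsIdempotentElem.mem_range_one_sub_iff {p : H →L[ℂ] H} (hp : IsIdempotentElem p) {x : H} :
    x ∈ (1 - p).range ↔ p x = 0 := by
  rw [hp.one_sub.mem_range_iff]
  simp

variable [CompleteSpace H] {p q : H →L[ℂ] H}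

theorem IsStarProjection.apply_apply (hp : IsStarProjection p) (x : H) : p (p x) = p x :=
  DFunLike.congr_fun hp.isIdempotentElem.eq x

theorem IsStarProjection.inner_apply_left (hp : IsStarProjection p) (x y : H) :
    ⟪p x, y⟫_ℂ = ⟪x, p y⟫_ℂ :=
  hp.isSelfAdjoint.isSymmetric x y

theorem IsStarProjection.completeSpace_range (hp : IsStarProjection p) : CompleteSpace p.range :=
  (ContinuousLinearMap.IsIdempotentElem.isClosed_range hp.isIdempotentElem).completeSpace_coe

theorem IsStarProjection.norm_sq_eq_add (hp : IsStarProjection p) (x : H) :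
    ‖x‖ ^ 2 = ‖p x‖ ^ 2 + ‖x - p x‖ ^ 2 := by
  have h : ⟪p x, x - p x⟫_ℂ = 0 := by
    rw [hp.inner_apply_left, map_sub, hp.apply_apply, sub_self, inner_zero_right]
  have := norm_add_sq_eq_norm_sq_add_norm_sq_of_inner_eq_zero _ _ h
  rw [add_sub_cancel] at this
  simpa only [sq] using this

theorem map_ker_restrictPair (hq : IsStarProjection q) :
    (restrictPair p q).ker.map p.range.subtype = p.range ⊓ (1 - q).range := by
  ext x
  simp only [Submodule.mem_map, Submodule.mem_inf, hq.isIdempotentElem.mem_range_one_sub_iff]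
  constructor
  · rintro ⟨y, hy, rfl⟩
    exact ⟨y.2, congrArg Subtype.val (LinearMap.mem_ker.mp hy)⟩
  · rintro ⟨h1, h2⟩
    exact ⟨⟨x, h1⟩, LinearMap.mem_ker.mpr (Subtype.ext h2), rfl⟩

theorem map_orthogonal_range_restrictPair (hp : IsStarProjection p) (hq : IsStarProjection q) :
    (restrictPair p q).rangeᗮ.map q.range.subtype = (1 - p).range ⊓ q.range := by
  ext x
  simp only [Submodule.mem_map, Submodule.mem_inf, hp.isIdempotentElem.mem_range_one_sub_iff]
  have key (y : q.range) (w : H) :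
      ⟪restrictPair p q ⟨p w, w, rfl⟩, y⟫_ℂ = ⟪w, p y⟫_ℂ := by
    rw [Submodule.coe_inner, coe_restrictPair_apply, hq.inner_apply_left,
      hq.isIdempotentElem.apply_of_mem_range y.2, hp.inner_apply_left]
  constructor
  · rintro ⟨y, hy, rfl⟩
    refine ⟨?_, y.2⟩
    rw [← inner_self_eq_zero (𝕜 := ℂ)]
    exact (key y _).symm.trans ((Submodule.mem_orthogonal _ _).mp hy _ ⟨_, rfl⟩)
  · rintro ⟨h1, h2⟩
    refine ⟨⟨x, h2⟩, (Submodule.mem_orthogonal _ _).mpr ?_, rfl⟩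
    rintro _ ⟨⟨_, w, rfl⟩, rfl⟩
    exact (key ⟨x, h2⟩ w).trans (by rw [h1, inner_zero_right])

theorem IsFredholmPair.finiteDimensional_inf_range_one_sub (hq : IsStarProjection q)
    (h : IsFredholmPair p q) :
    FiniteDimensional ℂ (p.range ⊓ (1 - q).range : Submodule ℂ H) := by
  rw [← map_ker_restrictPair hq]
  have := h.finite_ker
  infer_instance

theorem IsFredholmPair.isCompl_range_orthogonal (hq : IsStarProjection q)
    (h : IsFredholmPair p q) :
    IsCompl (restrictPair p q).range (restrictPair p q).rangeᗮ := by
  have := hq.completeSpace_range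
  have : CompleteSpace (restrictPair p q).range := h.isClosed_range.completeSpace_coe
  exact Submodule.isCompl_orthogonal _

theorem IsFredholmPair.finiteDimensional_range_one_sub_inf (hp : IsStarProjection p)
    (hq : IsStarProjection q) (h : IsFredholmPair p q) :
    FiniteDimensional ℂ ((1 - p).range ⊓ q.range : Submodule ℂ H) := by
  rw [← map_orthogonal_range_restrictPair hp hq]
  have := h.finite_coker
  have := Module.Finite.equiv (Submodule.quotientEquivOfIsCompl _ _
    (h.isCompl_range_orthogonal hq))
  infer_instance

theorem IsFredholmPair.pairIndex_eq (hp : IsStarProjection p) (hq : IsStarProjection q)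
    (h : IsFredholmPair p q) :
    pairIndex p q = (Module.finrank ℂ (p.range ⊓ (1 - q).range : Submodule ℂ H) : ℤ) -
      Module.finrank ℂ ((1 - p).range ⊓ q.range : Submodule ℂ H) := by
  rw [pairIndex, fredholmIndex, ← map_ker_restrictPair hq,
    ← map_orthogonal_range_restrictPair hp hq,
    Submodule.finrank_map_subtype_eq, Submodule.finrank_map_subtype_eq,
    (Submodule.quotientEquivOfIsCompl _ _ (h.isCompl_range_orthogonal hq)).finrank_eq]

/-- The open mapping theorem onto the closed range gives preimages of controlled norm. The first
bound compares `x` with such a preimage of `q x`; the second is the dual estimate for the adjoint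
`p|_{qH}`. -/
theorem IsFredholmPair.exists_norm_le (hp : IsStarProjection p) (hq : IsStarProjection q)
    (h : IsFredholmPair p q) :
    ∃ C : ℝ, 1 ≤ C ∧
      (∀ x ∈ p.range, x ∈ (p.range ⊓ (1 - q).range)ᗮ → ‖x‖ ≤ C * ‖q x‖) ∧
      ∀ y ∈ q.range, y ∈ ((1 - p).range ⊓ q.range)ᗮ → ‖y‖ ≤ C * ‖p y‖ := by
  have := hp.completeSpace_range
  have := hq.completeSpace_range
  have : CompleteSpace (restrictPair p q).range := h.isClosed_range.completeSpace_coe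
  obtain ⟨C, hC, hpre⟩ := (restrictPair p q).rangeRestrict.exists_preimage_norm_le
    (LinearMap.surjective_rangeRestrict _)
  have hpre' : ∀ y ∈ (restrictPair p q).range, ∃ x ∈ p.range, q x = y ∧ ‖x‖ ≤ C * ‖(y : H)‖ := by
    intro y hy
    obtain ⟨x, hx, hxn⟩ := hpre ⟨y, hy⟩
    exact ⟨x, x.2, congrArg (fun z : (restrictPair p q).range => ((z : q.range) : H)) hx, hxn⟩
  have bound (x v : H) (h : ⟪x, x⟫_ℂ = ⟪x, v⟫_ℂ) : ‖x‖ ≤ ‖v‖ := by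
    have h1 := norm_inner_le_norm (𝕜 := ℂ) x v
    rw [← h, inner_self_eq_norm_sq_to_K, norm_pow, RCLike.norm_ofReal, abs_norm, sq] at h1
    rcases eq_or_lt_of_le (norm_nonneg x) with h0 | h0
    · rw [← h0]; exact norm_nonneg v
    · exact le_of_mul_le_mul_left h1 h0
  -- Enlarging `C` ensures `1 ≤ C`, so that `1 - C⁻²` is nonnegative later.
  refine ⟨C + 1, by linarith, fun x hx hxo => ?_, fun y hy hyo => ?_⟩
  · obtain ⟨x', hx', hxx', hxn⟩ := hpre' _ ⟨⟨x, hx⟩, rfl⟩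
    change q x' = q x at hxx'
    change ‖x'‖ ≤ C * ‖q x‖ at hxn
    have hk : x - x' ∈ p.range ⊓ (1 - q).range :=
      ⟨Submodule.sub_mem _ hx hx', hq.isIdempotentElem.mem_range_one_sub_iff.mpr
        (by rw [map_sub, hxx', sub_self])⟩
    have h1 := (Submodule.mem_orthogonal' _ _).mp hxo _ hk
    rw [inner_sub_right, sub_eq_zero] at h1
    refine (bound _ _ h1).trans (hxn.trans ?_)
    gcongr
    linarith
  -- The range is closed, hence equal to its double orthogonal complement.
  · have hyr : (⟨y, hy⟩ : q.range) ∈ (restrictPair p q).range := by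
      rw [← (restrictPair p q).range.orthogonal_orthogonal, Submodule.mem_orthogonal]
      intro z hz
      refine (Submodule.mem_orthogonal _ _).mp hyo z ?_
      rw [← map_orthogonal_range_restrictPair hp hq]
      exact ⟨z, hz, rfl⟩
    obtain ⟨x, hx, hxy, hxn⟩ := hpre' _ hyr
    change q x = y at hxy
    change ‖x‖ ≤ C * ‖y‖ at hxn
    have h1 : ⟪y, y⟫_ℂ = ⟪x, p y⟫_ℂ := by
      rw [← hp.inner_apply_left, hp.isIdempotentElem.apply_of_mem_range hx]
      nth_rw 1 [← hxy]
      rw [hq.inner_apply_left, hq.isIdempotentElem.apply_of_mem_range hy]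
    have h2 := norm_inner_le_norm (𝕜 := ℂ) x (p y)
    rw [← h1, inner_self_eq_norm_sq_to_K, norm_pow, RCLike.norm_ofReal, abs_norm, sq] at h2
    rcases eq_or_lt_of_le (norm_nonneg y) with h0 | h0
    · rw [← h0]; positivity
    · have h3 : ‖y‖ * ‖y‖ ≤ ‖y‖ * (C * ‖p y‖) :=
        h2.trans ((mul_le_mul_of_nonneg_right hxn (norm_nonneg _)).trans_eq (by ring))
      refine (le_of_mul_le_mul_left h3 h0).trans ?_
      gcongr
      linarith

theorem IsStarProjection.norm_sub_apply_sq_le (hq : IsStarProjection q) {C : ℝ} (hC : 0 < C)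
    {x : H} (hx : ‖x‖ ≤ C * ‖q x‖) : ‖x - q x‖ ^ 2 ≤ (1 - (C ^ 2)⁻¹) * ‖x‖ ^ 2 := by
  have h1 := hq.norm_sq_eq_add x
  have h2 : ‖x‖ ^ 2 ≤ C ^ 2 * ‖q x‖ ^ 2 := by
    rw [← mul_pow]; gcongr
  have h3 : (C ^ 2)⁻¹ * ‖x‖ ^ 2 ≤ ‖q x‖ ^ 2 := by
    rwa [inv_mul_le_iff₀ (by positivity)]
  linarith

theorem norm_sub_apply_sq_le_of_mem_orthogonal (hp : IsStarProjection p) (hq : IsStarProjection q)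
    {C : ℝ} (hC : 1 ≤ C)
    (h1 : ∀ x ∈ p.range, x ∈ (p.range ⊓ (1 - q).range)ᗮ → ‖x‖ ≤ C * ‖q x‖)
    (h2 : ∀ y ∈ q.range, y ∈ ((1 - p).range ⊓ q.range)ᗮ → ‖y‖ ≤ C * ‖p y‖)
    {x : H} (hx1 : x ∈ (p.range ⊓ (1 - q).range)ᗮ) (hx2 : x ∈ ((1 - p).range ⊓ q.range)ᗮ) :
    ‖(p - q) x‖ ^ 2 ≤ (1 - (C ^ 2)⁻¹) * ‖x‖ ^ 2 := by
  have hC0 : 0 < C := by linarith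
  rw [Submodule.mem_orthogonal] at hx1 hx2
  simp only [Submodule.mem_inf, hp.isIdempotentElem.mem_range_one_sub_iff,
    hq.isIdempotentElem.mem_range_one_sub_iff, hp.isIdempotentElem.mem_range_iff,
    hq.isIdempotentElem.mem_range_iff, Submodule.mem_orthogonal] at h1 h2 hx1 hx2
  have e1 : ‖q x - p (q x)‖ ^ 2 ≤ (1 - (C ^ 2)⁻¹) * ‖q x‖ ^ 2 := by
    refine hp.norm_sub_apply_sq_le hC0 (h2 _ (hq.apply_apply x) fun k hk => ?_)
    rw [← hq.inner_apply_left, hk.2, hx2 k hk]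
  set w := x - q x with hw
  have hqw : q w = 0 := by rw [hw, map_sub, hq.apply_apply, sub_self]
  have e2 : ‖p w - q (p w)‖ ^ 2 ≤ (1 - (C ^ 2)⁻¹) * ‖p w‖ ^ 2 := by
    refine hq.norm_sub_apply_sq_le hC0 (h1 _ (hp.apply_apply w) fun k hk => ?_)
    rw [← hp.inner_apply_left, hk.1, hw, inner_sub_right, hx1 k hk, ← hq.inner_apply_left, hk.2,
      inner_zero_left, sub_zero]
  -- Duality: `e2` bounds `(1-q)p` at `p w`. Since `w = (1-q)w`, Cauchy–Schwarz on `⟪(1-q)p w, w⟫ =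
  -- ‖p w‖²` transfers the bound to `p` at `w`.
  have e3 : ‖p w‖ ^ 2 ≤ ‖p w - q (p w)‖ * ‖w‖ := by
    have h3 : ⟪p w - q (p w), w⟫_ℂ = ⟪p w, p w⟫_ℂ := by
      rw [inner_sub_left, hq.inner_apply_left, hqw, inner_zero_right, sub_zero,
        hp.inner_apply_left, hp.inner_apply_left, hp.apply_apply]
    have h4 := norm_inner_le_norm (𝕜 := ℂ) (p w - q (p w)) w
    rwa [h3, inner_self_eq_norm_sq_to_K, norm_pow, RCLike.norm_ofReal, abs_norm] at h4
  have hδ : 0 ≤ 1 - (C ^ 2)⁻¹ := sub_nonneg.mpr (inv_le_one_of_one_le₀ (one_le_pow₀ hC))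
  have e4 : ‖p w‖ ^ 2 ≤ (1 - (C ^ 2)⁻¹) * ‖w‖ ^ 2 := by
    rcases eq_or_lt_of_le (norm_nonneg (p w)) with h0 | h0
    · rw [← h0, zero_pow two_ne_zero]; exact mul_nonneg hδ (sq_nonneg _)
    · refine le_of_mul_le_mul_left ?_ (pow_pos h0 2)
      calc ‖p w‖ ^ 2 * ‖p w‖ ^ 2 ≤ (‖p w - q (p w)‖ * ‖w‖) * (‖p w - q (p w)‖ * ‖w‖) := by gcongr
        _ = ‖p w - q (p w)‖ ^ 2 * ‖w‖ ^ 2 := by ring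
        _ ≤ ((1 - (C ^ 2)⁻¹) * ‖p w‖ ^ 2) * ‖w‖ ^ 2 := by gcongr
        _ = _ := by ring
  -- Pythagoras along `p`: the components of `(p-q)x` are `p w` and `-(1-p)qx`.
  have e5 := hp.norm_sq_eq_add ((p - q) x)
  have e6 : p ((p - q) x) = p w := by simp [hw, hp.apply_apply]
  have e7 : (p - q) x - p w = -(q x - p (q x)) := by
    simp [hw]
  rw [e6, e7, norm_neg] at e5
  have e8 := hq.norm_sq_eq_add x
  rw [e5, e8, mul_add]
  linarith

theorem IsFredholmPair.essNorm_sub_lt_one (hp : IsStarProjection p) (hq : IsStarProjection q)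
    (h : IsFredholmPair p q) : essNorm (p - q) < 1 := by
  obtain ⟨C, hC, h1, h2⟩ := h.exists_norm_le hp hq
  have := h.finiteDimensional_inf_range_one_sub hq
  have := h.finiteDimensional_range_one_sub_inf hp hq
  let V := p.range ⊓ (1 - q).range ⊔ (1 - p).range ⊓ q.range
  have : FiniteDimensional ℂ V := Submodule.finiteDimensional_sup _ _
  -- Cutting `p - q` down to `Vᗮ` changes it only by an operator factoring through the finite
  -- dimensional `V`.
  refine essNorm_lt_of_hasFiniteRange_sub (y := (p - q) ∘L Vᗮ.starProjection) ?_
    (lt_of_le_of_lt (b := √(1 - (C ^ 2)⁻¹)) ?_ ?_)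
  · have h3 : (p - q) - (p - q) ∘L Vᗮ.starProjection = (p - q) ∘L V.starProjection := by
      rw [Submodule.starProjection_orthogonal']
      ext x
      simp
    rw [h3]
    refine LinearMap.HasFiniteRange.comp_left (u := V.starProjection.toLinearMap) ?_ _
    rw [LinearMap.HasFiniteRange, Submodule.range_starProjection]
    exact Module.Finite.iff_fg.mp this
  · refine ContinuousLinearMap.opNorm_le_bound _ (Real.sqrt_nonneg _) fun x => ?_
    have hx := Vᗮ.starProjection_apply_mem x
    have h4 := norm_sub_apply_sq_le_of_mem_orthogonal hp hq hC h1 h2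
      (Submodule.orthogonal_le le_sup_left hx) (Submodule.orthogonal_le le_sup_right hx)
    have hδ : 0 ≤ 1 - (C ^ 2)⁻¹ := sub_nonneg.mpr (inv_le_one_of_one_le₀ (one_le_pow₀ hC))
    refine (Real.le_sqrt_of_sq_le h4).trans ?_
    rw [Real.sqrt_mul hδ, Real.sqrt_sq (norm_nonneg _)]
    gcongr
    exact Submodule.norm_starProjection_apply_le _ _
  · rw [Real.sqrt_lt' one_pos, one_pow, sub_lt_self_iff]
    positivity

end EssNormOfFredholm

/-! ### Traces of the meets and the main theorem. -/

section Trace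

variable {H : Type*} [NormedAddCommGroup H] [InnerProductSpace ℂ H] [CompleteSpace H]
  {p q : H →L[ℂ] H}

theorem opTrace_projInf (h : FiniteDimensional ℂ (p.range ⊓ q.range : Submodule ℂ H)) :
    opTrace (projInf p q) = Module.finrank ℂ (p.range ⊓ q.range : Submodule ℂ H) := by
  have h1 : (p.range ⊓ q.range).topologicalClosure = p.range ⊓ q.range :=
    IsClosed.submodule_topologicalClosure_eq (Submodule.closed_of_finiteDimensional _)
  have : FiniteDimensional ℂ (p.range ⊓ q.range).topologicalClosure := by rwa [h1]
  rw [projInf, opTrace_starProjection, h1]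

end Trace

theorem mainTheorem4 {H : Type*} [NormedAddCommGroup H] [InnerProductSpace ℂ H] [CompleteSpace H]
    [TopologicalSpace.SeparableSpace H] (hH : ¬ FiniteDimensional ℂ H)
    (p q : H →L[ℂ] H) (hp : IsStarProjection p) (hq : IsStarProjection q) :
    (IsFredholmPair p q ↔ essNorm (p - q) < 1) ∧
    (IsFredholmPair p q →
      IsFiniteProj (projInf p (1 - q)) ∧ IsFiniteProj (projInf (1 - p) q) ∧
      opTrace (projInf p (1 - q)) < ∞ ∧ opTrace (projInf (1 - p) q) < ∞ ∧
      (pairIndex p q : ℝ) =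
        (opTrace (projInf p (1 - q))).toReal - (opTrace (projInf (1 - p) q)).toReal) := by
  refine ⟨⟨fun h => h.essNorm_sub_lt_one hp hq, isFredholmPair_of_essNorm_lt_one hp hq⟩,
    fun h => ?_⟩
  have h1 := h.finiteDimensional_inf_range_one_sub hq
  have h2 := h.finiteDimensional_range_one_sub_inf hp hq
  rw [opTrace_projInf h1, opTrace_projInf h2, IsFiniteProj,
    IsFiniteProj, range_projInf hp hq.one_sub, range_projInf hp.one_sub hq]
  refine ⟨h1, h2, ENNReal.natCast_lt_top _, ENNReal.natCast_lt_top _, ?_⟩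
  rw [h.pairIndex_eq hp hq]
  simp
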